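/- Let $\alpha_1,\alpha_2>0$ be real numbers and let $f(x)=x_1^{\alpha_1}x_2^{\alpha_2}$ for $x=(x_1,x_2)\in\mathbb{R}^2$. Here, for a negative base $t<0$, the power $t^{\alpha_i}$ is understood as $c_i\,|t|^{\alpha_i}$ with an arbitrary fixed real constant $c_i\neq 0$: for an integer exponent, $c_i=(-1)^{\alpha_i}$ gives the ordinary power, and $c_i=1$ gives $|t|^{\alpha_i}$. Let $\Sigma$ be any real positive semidefinite $2\times 2$ matrix with positive diagonal entries, let $X\sim N_2(0,\Sigma)$ be a normal random vector with mean zero and covariance matrix $\Sigma$, and let $$W_{f,\Sigma}=\frac{f(X)^2}{(\nabla f(X))^{T}\,\Sigma\,\nabla f(X)},$$ which is well defined almost surely. Then $$W_{f,\Sigma}\;\sim\;\frac{1}{(\alpha_1+\alpha_2)^2}\,\chi^2_1,$$ where $\chi^2_1$ is the chi-square distribution with one degree of freedom, i.e. the law of $Z^2$ for a standard normal $Z$. In particular, the distribution of $W_{f,\Sigma}$ does not depend on $\Sigma$. -/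

import Mathlib

open MeasureTheory ProbabilityTheory

noncomputable section

/-- The power `x ^ α` on the whole real line: the usual power for `x ≥ 0`, continued to the
negative half-line as `c * (-x) ^ α`, i.e. with the constant `c` playing the role of `(-1) ^ α`.
For an integer exponent and `c = (-1) ^ α` this is the ordinary power (`signedPow_natCast`), for
`c = 1` it is `|x| ^ α` (`signedPow_one`). -/
def signedPow (c α x : ℝ) : ℝ :=
  if 0 ≤ x then x ^ α else c * (-x) ^ α

theorem signedPow_natCast (n : ℕ) (x : ℝ) : signedPow ((-1) ^ n) (n : ℝ) x = x ^ n := by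
  unfold signedPow
  split_ifs with h
  · exact Real.rpow_natCast x n
  · rw [Real.rpow_natCast, ← mul_pow, neg_one_mul, neg_neg]

theorem signedPow_one (α x : ℝ) : signedPow 1 α x = |x| ^ α := by
  unfold signedPow
  split_ifs with h
  · rw [abs_of_nonneg h]
  · rw [one_mul, abs_of_neg (not_le.mp h)]

/-- The bivariate function `x ↦ x₁ ^ α₁ * x₂ ^ α₂`. -/
def bivariateMonomial (c₁ c₂ α₁ α₂ : ℝ) (x : EuclideanSpace ℝ (Fin 2)) : ℝ :=
  signedPow c₁ α₁ (x 0) * signedPow c₂ α₂ (x 1)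

/-- The ratio `f(x)² / (∇f(x)ᵀ Σ ∇f(x))`; evaluated at `X ∼ N(0, Σ)` it is the random variable
`W_{f,Σ}`. -/
def waldRatio {k : ℕ} (f : EuclideanSpace ℝ (Fin k) → ℝ) (S : Matrix (Fin k) (Fin k) ℝ)
    (x : EuclideanSpace ℝ (Fin k)) : ℝ :=
  f x ^ 2 / dotProduct (gradient f x).ofLp (S.mulVec (gradient f x).ofLp)

/-- The chi-square distribution with one degree of freedom: the law of the square of a standard
normal random variable. -/
def chiSquareOne : Measure ℝ :=
  (gaussianReal 0 1).map (fun z => z ^ 2)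

end

/-! Off the axes ∇f = f · (α₁/x₁, α₂/x₂), so f² cancels and W is an explicit rational function of X.
Writing X through a standard Gaussian pair with correlation ρ and τ² = 1 - ρ², polar coordinates
give W = r²U(t)/(α₁+α₂)², with t uniform and independent of r. It remains to see that U(t) has the
law of cos² t (`map_angularPart_eq`), since r cos t is standard normal. For τ ≠ 0, U = (1 + Re B)/2
on the unit circle for a Blaschke product B with B(0) = 0 (`exists_blaschke_re_eq`), while cos² t =
(1 + Re z²)/2. By the mean value property all positive powers of B and of z² average to zero, which
forces Re B and Re z² to be equidistributed (`integral_comp_re_eq`). -/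

/-! ### Equidistribution of real parts of unimodular functions -/

open Real in
/-- Real parts of unimodular functions whose positive powers have mean zero share all mixed
moments. -/
lemma integral_re_pow_mul_re_pow_eq {b b' : ℝ → ℂ} (hb : Continuous b) (hb' : Continuous b')
    (hn : ∀ t, ‖b t‖ = 1) (hn' : ∀ t, ‖b' t‖ = 1)
    (h0 : ∀ k : ℕ, k ≠ 0 → ∫ t in 0..2 * π, b t ^ k = 0)
    (h0' : ∀ k : ℕ, k ≠ 0 → ∫ t in 0..2 * π, b' t ^ k = 0) (n k : ℕ) :
    ∫ t in 0..2 * π, (b t).re ^ n * (b t ^ k).re =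
      ∫ t in 0..2 * π, (b' t).re ^ n * (b' t ^ k).re := by
  have re_integral : ∀ {c : ℝ → ℂ}, Continuous c →
      (∀ k : ℕ, k ≠ 0 → ∫ t in 0..2 * π, c t ^ k = 0) → ∀ k : ℕ, k ≠ 0 →
      ∫ t in 0..2 * π, (c t ^ k).re = 0 := by
    intro c hc h k hk
    have := intervalIntegral.intervalIntegral_re (𝕜 := ℂ) (μ := volume) (a := 0) (b := 2 * π)
      (f := fun t => c t ^ k) ((hc.pow k).intervalIntegrable _ _)
    rw [h k hk] at this
    simpa using this
  -- With c = e^{iθ} this is 2 cos θ cos((k+1)θ) = cos((k+2)θ) + cos(kθ); it lowers the exponent n.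
  have step : ∀ {c : ℝ → ℂ}, Continuous c → (∀ t, ‖c t‖ = 1) → ∀ n k : ℕ,
      ∫ t in 0..2 * π, (c t).re ^ (n + 1) * (c t ^ (k + 1)).re =
        ((∫ t in 0..2 * π, (c t).re ^ n * (c t ^ (k + 2)).re) +
          ∫ t in 0..2 * π, (c t).re ^ n * (c t ^ k).re) / 2 := by
    intro c hc hcn n k
    rw [← intervalIntegral.integral_add (Continuous.intervalIntegrable (by fun_prop) _ _)
      (Continuous.intervalIntegrable (by fun_prop) _ _), ← intervalIntegral.integral_div]
    congr 1 with t
    have h1 : (c t).re * (c t).re + (c t).im * (c t).im = 1 := by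
      rw [← Complex.normSq_apply, Complex.normSq_eq_norm_sq, hcn, one_pow]
    have e1 : (c t ^ (k + 1)).re = (c t ^ k).re * (c t).re - (c t ^ k).im * (c t).im := by
      rw [pow_succ, Complex.mul_re]
    have e2 : (c t ^ (k + 2)).re = (c t ^ k).re * ((c t).re * (c t).re - (c t).im * (c t).im)
        - (c t ^ k).im * (2 * (c t).re * (c t).im) := by
      rw [pow_add, Complex.mul_re, pow_two, Complex.mul_re, Complex.mul_im]; ring
    rw [e1, e2]
    linear_combination ((c t).re ^ n * (c t ^ k).re / 2) * h1
  induction n generalizing k with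
  | zero =>
    rcases Nat.eq_zero_or_pos k with rfl | hk
    · simp
    · simp only [pow_zero, one_mul]
      rw [re_integral hb h0 k hk.ne', re_integral hb' h0' k hk.ne']
  | succ n ih =>
    cases k with
    | zero => simpa [pow_succ] using ih 1
    | succ k => rw [step hb hn, step hb' hn', ih, ih]

-- The moments settle polynomials, and Weierstrass approximation on [-1, 1], which contains both
-- real parts, settles continuous functions.
open Real Polynomial in
lemma integral_comp_re_eq {b b' : ℝ → ℂ} (hb : Continuous b) (hb' : Continuous b')
    (hn : ∀ t, ‖b t‖ = 1) (hn' : ∀ t, ‖b' t‖ = 1)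
    (h0 : ∀ k : ℕ, k ≠ 0 → ∫ t in 0..2 * π, b t ^ k = 0)
    (h0' : ∀ k : ℕ, k ≠ 0 → ∫ t in 0..2 * π, b' t ^ k = 0) {h : ℝ → ℝ} (hh : Continuous h) :
    ∫ t in 0..2 * π, h (b t).re = ∫ t in 0..2 * π, h (b' t).re := by
  have hpoly : ∀ p : ℝ[X], ∫ t in 0..2 * π, p.eval (b t).re = ∫ t in 0..2 * π, p.eval (b' t).re := by
    intro p
    simp only [Polynomial.eval_eq_sum_range]
    rw [intervalIntegral.integral_finsetSum
        (fun i _ => Continuous.intervalIntegrable (by fun_prop) _ _),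
      intervalIntegral.integral_finsetSum
        (fun i _ => Continuous.intervalIntegrable (by fun_prop) _ _)]
    refine Finset.sum_congr rfl fun i _ => ?_
    rw [intervalIntegral.integral_const_mul, intervalIntegral.integral_const_mul]
    have := integral_re_pow_mul_re_pow_eq hb hb' hn hn' h0 h0' i 0
    simp only [pow_zero, Complex.one_re, mul_one] at this
    rw [this]
  have near : ∀ {c : ℝ → ℂ}, Continuous c → (∀ t, ‖c t‖ = 1) → ∀ (p : ℝ[X]) (ε : ℝ),
      (∀ x ∈ Set.Icc (-1 : ℝ) 1, |p.eval x - h x| < ε) →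
      |(∫ t in 0..2 * π, p.eval (c t).re) - ∫ t in 0..2 * π, h (c t).re| ≤ ε * (2 * π) := by
    intro c hc hcn p ε hp
    rw [← intervalIntegral.integral_sub
      (Continuous.intervalIntegrable (by fun_prop) _ _)
      (Continuous.intervalIntegrable (by fun_prop) _ _), ← Real.norm_eq_abs]
    refine (intervalIntegral.norm_integral_le_of_norm_le_const (C := ε) fun t _ => ?_).trans_eq ?_
    · refine (hp _ ?_).le
      have := Complex.abs_re_le_norm (c t)
      rw [hcn] at this
      exact abs_le.mp this
    · rw [sub_zero, abs_of_pos (by positivity)]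
  refine eq_of_forall_dist_le fun ε hε => ?_
  have hpi := Real.pi_pos
  obtain ⟨p, hp⟩ := exists_polynomial_near_of_continuousOn (-1) 1 h hh.continuousOn
    (ε / (4 * π)) (by positivity)
  have h1 := abs_le.mp (near hb hn p _ hp)
  have h2 := abs_le.mp (near hb' hn' p _ hp)
  rw [hpoly p] at h1
  have e : ε / (4 * π) * (2 * π) = ε / 2 := by field_simp; norm_num
  rw [e] at h1 h2
  rw [Real.dist_eq, abs_le]
  constructor <;> linarith [h1.1, h1.2, h2.1, h2.2]

/-! ### Blaschke product and law of the angular part -/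

open Real in
/-- Positive powers of a disc function vanishing at the origin have mean zero on the circle. -/
lemma integral_circleMap_pow_eq_zero {B : ℂ → ℂ} (hB : DiffContOnCl ℂ B (Metric.ball 0 1))
    (h0 : B 0 = 0) (k : ℕ) (hk : k ≠ 0) : ∫ t in 0..2 * π, B (circleMap 0 1 t) ^ k = 0 := by
  have hBk : DiffContOnCl ℂ (fun z => B z ^ k) (Metric.ball 0 |1|) := by
    rw [abs_one]
    exact ⟨hB.differentiableOn.pow k, hB.continuousOn.pow k⟩
  have := hBk.circleAverage
  rw [circleAverage_def, h0, zero_pow hk, smul_eq_zero] at this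
  exact this.resolve_left (by positivity)

open Real ComplexConjugate in
/-- If the rotation `ρ + iτ` is not real, the angular part of the ratio is `(1 + Re B) / 2` on the
circle, for a Blaschke product `B` with `B 0 = 0`. -/
lemma exists_blaschke_re_eq {p q ρ τ : ℝ} (hp : 0 < p) (hq : 0 < q) (hpq : p + q = 1)
    (h : ρ ^ 2 + τ ^ 2 = 1) (hτ : τ ≠ 0) :
    ∃ B : ℂ → ℂ, DiffContOnCl ℂ B (Metric.ball 0 1) ∧ B 0 = 0 ∧
      Continuous (fun t => B (circleMap 0 1 t)) ∧ (∀ t, ‖B (circleMap 0 1 t)‖ = 1) ∧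
      ∀ t, cos t ^ 2 * (ρ * cos t + τ * sin t) ^ 2 /
        (p ^ 2 * (ρ * cos t + τ * sin t) ^ 2 + 2 * p * q * ρ * cos t * (ρ * cos t + τ * sin t)
          + q ^ 2 * cos t ^ 2) = (1 + (B (circleMap 0 1 t)).re) / 2 := by
  -- For N = w̄z² + a on the circle, (Re N)² is four times the numerator and |N|² four times the
  -- denominator. Hence the ratio is (Re N)²/|N|² = (1 + Re(N/N̄))/2, and z²N̄ = w + āz² turns N/N̄
  -- into a function holomorphic in the disc.
  set w : ℂ := ⟨ρ, τ⟩ with hw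
  set a : ℂ := ⟨ρ, (p - q) * τ⟩ with ha
  have hwn : ‖w‖ = 1 := by
    rw [← sq_eq_sq₀ (norm_nonneg _) zero_le_one, ← Complex.normSq_eq_norm_sq, Complex.normSq_apply]
    simp only [hw]; linarith
  -- |a|² = 1 - 4pqτ²; this is where τ ≠ 0 enters, keeping the poles outside the closed disc.
  have han : ‖a‖ < 1 := by
    rw [← sq_lt_sq₀ (norm_nonneg _) zero_le_one, ← Complex.normSq_eq_norm_sq, Complex.normSq_apply]
    simp only [ha]
    have : 0 < p * q * τ ^ 2 := by positivity
    obtain rfl : q = 1 - p := by linarith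
    nlinarith
  have hden : ∀ z : ℂ, ‖z‖ ≤ 1 → w + conj a * z ^ 2 ≠ 0 := by
    intro z hz h0
    have h1 : ‖w‖ = ‖conj a * z ^ 2‖ := by rw [eq_neg_of_add_eq_zero_left h0, norm_neg]
    rw [hwn, norm_mul, RCLike.norm_conj, norm_pow] at h1
    have : ‖z‖ ^ 2 ≤ 1 := pow_le_one₀ (norm_nonneg _) hz
    nlinarith [norm_nonneg a]
  have hcont : ContinuousOn (fun z => z ^ 2 * (conj w * z ^ 2 + a) / (w + conj a * z ^ 2))
      (Metric.closedBall 0 1) := by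
    refine ContinuousOn.div (by fun_prop) (by fun_prop) fun z hz => hden z (by simpa using hz)
  have hcirc : ∀ t, conj (circleMap 0 1 t) * circleMap 0 1 t = 1 := by
    intro t
    rw [mul_comm, Complex.mul_conj, Complex.normSq_eq_norm_sq, norm_circleMap_zero]
    simp
  have hdN : ∀ t, w + conj a * circleMap 0 1 t ^ 2 =
      circleMap 0 1 t ^ 2 * conj (conj w * circleMap 0 1 t ^ 2 + a) := by
    intro t
    simp only [map_add, map_mul, map_pow, Complex.conj_conj]
    linear_combination (-w) * (conj (circleMap 0 1 t) * circleMap 0 1 t + 1) * hcirc t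
  have hNne : ∀ t, conj w * circleMap 0 1 t ^ 2 + a ≠ 0 := by
    intro t h0
    refine hden (circleMap 0 1 t) (by simp) ?_
    rw [hdN, h0]; simp
  have hBN : ∀ t, circleMap 0 1 t ^ 2 * (conj w * circleMap 0 1 t ^ 2 + a) /
      (w + conj a * circleMap 0 1 t ^ 2) = (conj w * circleMap 0 1 t ^ 2 + a) /
        conj (conj w * circleMap 0 1 t ^ 2 + a) := by
    intro t
    rw [hdN, mul_div_mul_left _ _ (pow_ne_zero 2 (circleMap_ne_center one_ne_zero))]
  refine ⟨fun z => z ^ 2 * (conj w * z ^ 2 + a) / (w + conj a * z ^ 2), ⟨?_, ?_⟩, by simp, ?_, ?_,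
    ?_⟩
  · refine DifferentiableOn.div (by fun_prop) (by fun_prop) fun z hz => hden z ?_
    exact (by simpa using hz : ‖z‖ < 1).le
  · rwa [closure_ball _ one_ne_zero]
  · exact hcont.comp_continuous (continuous_circleMap 0 1) fun t => by simp
  · intro t
    simp only
    rw [hBN, norm_div, RCLike.norm_conj, div_self (norm_ne_zero_iff.2 (hNne t))]
  · intro t
    simp only
    rw [hBN]
    set N := conj w * circleMap 0 1 t ^ 2 + a with hN
    have hsc := sin_sq_add_cos_sq t
    have hre : N.re = 2 * (cos t * (ρ * cos t + τ * sin t)) := by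
      simp [hN, hw, ha, circleMap_zero, pow_two, Complex.exp_ofReal_mul_I_re,
        Complex.exp_ofReal_mul_I_im]
      linear_combination (-ρ) * hsc
    have him : N.im = 2 * (p * sin t * (ρ * cos t + τ * sin t) +
        q * cos t * (ρ * sin t - τ * cos t)) := by
      simp [hN, hw, ha, circleMap_zero, pow_two, Complex.exp_ofReal_mul_I_re,
        Complex.exp_ofReal_mul_I_im]
      linear_combination (-(2 * ρ * sin t * cos t + τ * (sin t ^ 2 - cos t ^ 2))) * hpq
        - τ * (p - q) * hsc
    have hsq : Complex.normSq N = 4 * (p ^ 2 * (ρ * cos t + τ * sin t) ^ 2 +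
        2 * p * q * ρ * cos t * (ρ * cos t + τ * sin t) + q ^ 2 * cos t ^ 2) := by
      rw [Complex.normSq_apply, hre, him]
      have h1 : cos t * (ρ * cos t + τ * sin t) = p * (cos t * (ρ * cos t + τ * sin t)) +
          q * (cos t * (ρ * cos t + τ * sin t)) := by
        rw [← add_mul, hpq, one_mul]
      have h2 : (ρ * cos t + τ * sin t) ^ 2 + (ρ * sin t - τ * cos t) ^ 2 = 1 := by
        linear_combination (ρ ^ 2 + τ ^ 2) * hsc + h
      have h3 : cos t * (ρ * cos t + τ * sin t) + sin t * (ρ * sin t - τ * cos t) = ρ := by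
        linear_combination ρ * hsc
      rw [h1]
      linear_combination (4 * p ^ 2 * (ρ * cos t + τ * sin t) ^ 2) * hsc +
        (4 * q ^ 2 * cos t ^ 2) * h2 + (8 * p * q * cos t * (ρ * cos t + τ * sin t)) * h3
    have hpos : 0 < Complex.normSq N := Complex.normSq_pos.2 (hNne t)
    have hdiv : (N / conj N).re = (N.re * N.re - N.im * N.im) / Complex.normSq N := by
      rw [Complex.div_re, Complex.normSq_conj, Complex.conj_re, Complex.conj_im]
      ring
    have e : N.re * N.re - N.im * N.im = 2 * N.re ^ 2 - Complex.normSq N := by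
      rw [Complex.normSq_apply]; ring
    rw [hdiv, e, hre, sub_div, div_self hpos.ne', hsq]
    rw [hsq] at hpos
    field_simp
    ring

open Real in
/-- The angular part of the ratio has the same law as the squared cosine of a uniform angle. -/
lemma map_angularPart_eq {p q ρ τ : ℝ} (hp : 0 < p) (hq : 0 < q) (hpq : p + q = 1)
    (h : ρ ^ 2 + τ ^ 2 = 1) :
    (volume.restrict (Set.Ioo (-π) π)).map (fun t => cos t ^ 2 * (ρ * cos t + τ * sin t) ^ 2 /
        (p ^ 2 * (ρ * cos t + τ * sin t) ^ 2 + 2 * p * q * ρ * cos t * (ρ * cos t + τ * sin t)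
          + q ^ 2 * cos t ^ 2)) =
      (volume.restrict (Set.Ioo (-π) π)).map (fun t => cos t ^ 2) := by
  by_cases hτ : τ = 0
  -- Perfect correlation: the two functions agree pointwise, including at cos t = 0, where 0/0 = 0.
  · congr 1 with t
    subst hτ
    have hρ : ρ ^ 2 = 1 := by linarith
    have e : p ^ 2 * (ρ * cos t + 0 * sin t) ^ 2 +
        2 * p * q * ρ * cos t * (ρ * cos t + 0 * sin t) + q ^ 2 * cos t ^ 2 = cos t ^ 2 := by
      linear_combination (p ^ 2 + 2 * p * q) * cos t ^ 2 * hρ + (p + q + 1) * cos t ^ 2 * hpq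
    rw [e, zero_mul, add_zero, mul_pow, hρ, one_mul, mul_self_div_self]
  obtain ⟨B, hB, hB0, hBc, hBn, hBre⟩ := exists_blaschke_re_eq hp hq hpq h hτ
  have hC : DiffContOnCl ℂ (fun z : ℂ => z ^ 2) (Metric.ball 0 1) :=
    (by fun_prop : Differentiable ℂ fun z : ℂ => z ^ 2).diffContOnCl
  have hCre : ∀ t, cos t ^ 2 = (1 + (circleMap 0 1 t ^ 2).re) / 2 := by
    intro t
    simp [circleMap_zero, pow_two, Complex.exp_ofReal_mul_I_re, Complex.exp_ofReal_mul_I_im]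
    linear_combination (1 / 2) * sin_sq_add_cos_sq t
  have hu : Measurable fun t : ℝ => (1 + (B (circleMap 0 1 t)).re) / 2 :=
    ((Complex.measurable_re.comp hBc.measurable).const_add 1).div_const 2
  have hv : Measurable fun t : ℝ => (1 + (circleMap 0 1 t ^ 2).re) / 2 := by
    simp only [← hCre]
    fun_prop
  simp only [hBre]
  simp only [hCre]
  refine ext_of_forall_integral_eq_of_IsFiniteMeasure fun g => ?_
  rw [integral_map hu.aemeasurable g.continuous.aestronglyMeasurable,
    integral_map hv.aemeasurable g.continuous.aestronglyMeasurable,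
    ← integral_Ioc_eq_integral_Ioo, ← integral_Ioc_eq_integral_Ioo,
    ← intervalIntegral.integral_of_le (by linarith [pi_pos]),
    ← intervalIntegral.integral_of_le (by linarith [pi_pos])]
  -- Polar coordinates use (-π, π), circle averages use [0, 2π].
  have shift : ∀ f : ℂ → ℝ, ∫ t in -π..π, f (circleMap 0 1 t) =
      ∫ t in 0..2 * π, f (circleMap 0 1 t) := by
    intro f
    have := ((periodic_circleMap 0 1).comp f).intervalIntegral_add_eq (-π) 0
    rw [zero_add, show -π + 2 * π = π by ring] at this
    exact this
  rw [shift fun z => g ((1 + (B z).re) / 2), shift fun z => g ((1 + (z ^ 2).re) / 2)]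
  exact integral_comp_re_eq (b := fun t => B (circleMap 0 1 t)) (b' := fun t => circleMap 0 1 t ^ 2)
    hBc (by fun_prop) hBn (fun t => by simp)
    (integral_circleMap_pow_eq_zero hB hB0) (integral_circleMap_pow_eq_zero hC (by simp))
    (h := fun x => g ((1 + x) / 2)) (by fun_prop)

/-! ### Gaussian pairs in polar coordinates -/

lemma gaussianPDF_mul_gaussianPDF_polar (r t : ℝ) :
    gaussianPDF 0 1 (r * Real.cos t) * gaussianPDF 0 1 (r * Real.sin t) =
      gaussianPDF 0 1 r * gaussianPDF 0 1 0 := by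
  simp only [gaussianPDF]
  rw [← ENNReal.ofReal_mul (gaussianPDFReal_nonneg _ _ _),
    ← ENNReal.ofReal_mul (gaussianPDFReal_nonneg _ _ _)]
  simp only [gaussianPDFReal]
  rw [mul_mul_mul_comm, ← Real.exp_add, mul_mul_mul_comm, ← Real.exp_add]
  congr 3
  simp only [NNReal.coe_one]
  linear_combination (-r ^ 2 / 2) * Real.sin_sq_add_cos_sq t

open Real in
lemma lintegral_gaussianReal_prod_polar {g : ℝ × ℝ → ENNReal} (hg : Measurable g) :
    ∫⁻ z, g z ∂(gaussianReal 0 1).prod (gaussianReal 0 1) =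
      ∫⁻ r in Set.Ioi (0 : ℝ), ENNReal.ofReal r * (gaussianPDF 0 1 r * gaussianPDF 0 1 0) *
        ∫⁻ t in Set.Ioo (-π) π, g (r * cos t, r * sin t) := by
  have hpdf : Measurable fun z : ℝ × ℝ => gaussianPDF 0 1 z.1 * gaussianPDF 0 1 z.2 := by
    fun_prop
  rw [gaussianReal_of_var_ne_zero 0 one_ne_zero,
    prod_withDensity (measurable_gaussianPDF 0 1) (measurable_gaussianPDF 0 1),
    lintegral_withDensity_eq_lintegral_mul _ hpdf hg, ← Measure.volume_eq_prod,
    ← lintegral_comp_polarCoord_symm, polarCoord_target, Measure.volume_eq_prod,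
    ← Measure.prod_restrict, lintegral_prod]
  · refine lintegral_congr fun r => ?_
    rw [← lintegral_const_mul _ (by fun_prop)]
    refine lintegral_congr fun t => ?_
    simp only [polarCoord_symm_apply, Pi.mul_apply, smul_eq_mul, gaussianPDF_mul_gaussianPDF_polar,
      mul_assoc]
  · have := continuous_polarCoord_symm.measurable
    refine Measurable.aemeasurable ?_
    exact (ENNReal.measurable_ofReal.comp measurable_fst).mul ((hpdf.mul hg).comp this)

open Real in
/-- Two functions of a standard Gaussian pair that are the squared radius times functions of the
angle have the same law as soon as their angular parts have the same law. -/
lemma map_gaussianReal_prod_eq_of_angular {Φ Ψ : ℝ × ℝ → ℝ} (hΦ : Measurable Φ) (hΨ : Measurable Ψ)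
    {U V : ℝ → ℝ} (hU : Measurable U) (hV : Measurable V) (κ : ℝ)
    (hΦU : ∀ r t, 0 < r → Φ (r * cos t, r * sin t) = κ * r ^ 2 * U t)
    (hΨV : ∀ r t, 0 < r → Ψ (r * cos t, r * sin t) = κ * r ^ 2 * V t)
    (h : (volume.restrict (Set.Ioo (-π) π)).map U = (volume.restrict (Set.Ioo (-π) π)).map V) :
    ((gaussianReal 0 1).prod (gaussianReal 0 1)).map Φ =
      ((gaussianReal 0 1).prod (gaussianReal 0 1)).map Ψ := by
  refine Measure.ext_of_lintegral _ fun f hf => ?_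
  rw [lintegral_map hf hΦ, lintegral_map hf hΨ,
    lintegral_gaussianReal_prod_polar (g := fun z => f (Φ z)) (hf.comp hΦ),
    lintegral_gaussianReal_prod_polar (g := fun z => f (Ψ z)) (hf.comp hΨ)]
  refine setLIntegral_congr_fun measurableSet_Ioi fun r hr => ?_
  simp only [hΦU r _ hr, hΨV r _ hr]
  congr 1
  -- At fixed r the inner integral depends only on the law of the angular part.
  have hfr : Measurable fun u => f (κ * r ^ 2 * u) := by fun_prop
  rw [← lintegral_map hfr hU, ← lintegral_map hfr hV, h]

-- Characteristic functions are compared because S may be singular (τ = 0), which rules out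
-- densities.
open Complex in
lemma multivariateGaussian_fin_two_eq_map {S : Matrix (Fin 2) (Fin 2) ℝ} (hS : S.PosSemidef)
    {σ₁ σ₂ ρ τ : ℝ} (h : ρ ^ 2 + τ ^ 2 = 1) (h₁ : S 0 0 = σ₁ ^ 2) (h₂ : S 1 1 = σ₂ ^ 2)
    (h₁₂ : S 0 1 = ρ * σ₁ * σ₂) :
    multivariateGaussian 0 S = ((gaussianReal 0 1).prod (gaussianReal 0 1)).map
      (fun z => !₂[σ₁ * z.1, σ₂ * (ρ * z.1 + τ * z.2)]) := by
  have hm : Measurable fun z : ℝ × ℝ => !₂[σ₁ * z.1, σ₂ * (ρ * z.1 + τ * z.2)] := by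
    refine (Continuous.measurable ?_)
    fun_prop
  have h₂₁ : S 1 0 = S 0 1 := by simpa using hS.isHermitian.apply 0 1
  have : IsProbabilityMeasure (((gaussianReal 0 1).prod (gaussianReal 0 1)).map
      (fun z => !₂[σ₁ * z.1, σ₂ * (ρ * z.1 + τ * z.2)])) :=
    Measure.isProbabilityMeasure_map hm.aemeasurable
  refine Measure.ext_of_charFun ?_
  ext x
  rw [charFun_multivariateGaussian hS, charFun_apply, integral_map hm.aemeasurable
    (Continuous.aestronglyMeasurable (by fun_prop))]
  have e : ∀ z : ℝ × ℝ, cexp (inner ℝ !₂[σ₁ * z.1, σ₂ * (ρ * z.1 + τ * z.2)] x * I) =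
      cexp (((x 0 * σ₁ + x 1 * σ₂ * ρ : ℝ) : ℂ) * z.1 * I) *
        cexp (((x 1 * σ₂ * τ : ℝ) : ℂ) * z.2 * I) := by
    intro z
    rw [← Complex.exp_add]
    congr 1
    simp [PiLp.inner_apply, Fin.sum_univ_two]
    ring
  simp_rw [e]
  rw [integral_prod_mul (fun y : ℝ => cexp (((x 0 * σ₁ + x 1 * σ₂ * ρ : ℝ) : ℂ) * y * I))
    (fun y : ℝ => cexp (((x 1 * σ₂ * τ : ℝ) : ℂ) * y * I)), ← charFun_apply_real,
    ← charFun_apply_real, charFun_gaussianReal, charFun_gaussianReal, ← Complex.exp_add]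
  congr 1
  have e2 : x.ofLp ⬝ᵥ S.mulVec x.ofLp =
      (x 0 * σ₁ + x 1 * σ₂ * ρ) ^ 2 + (x 1 * σ₂ * τ) ^ 2 := by
    simp only [dotProduct, Matrix.mulVec, Fin.sum_univ_two, h₂₁, h₁, h₂, h₁₂]
    linear_combination (-(x 1 ^ 2 * σ₂ ^ 2)) * h
  rw [e2]
  simp
  ring

/-! ### Gradient and closed form of the ratio -/

lemma signedPow_ne_zero {c x : ℝ} (hc : c ≠ 0) (α : ℝ) (hx : x ≠ 0) : signedPow c α x ≠ 0 := by
  unfold signedPow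
  split_ifs with h
  · exact (Real.rpow_pos_of_pos (lt_of_le_of_ne h hx.symm) α).ne'
  · exact mul_ne_zero hc (Real.rpow_pos_of_pos (by linarith) α).ne'

/-- The logarithmic derivative α / x is the same on both half-lines, whatever c is. -/
lemma hasDerivAt_signedPow (c α : ℝ) {x : ℝ} (hx : x ≠ 0) :
    HasDerivAt (signedPow c α) (signedPow c α x * (α / x)) x := by
  rcases lt_or_gt_of_ne hx with h | h
  · have hd : HasDerivAt (fun y : ℝ => c * (-y) ^ α) (c * (-1 * α * (-x) ^ (α - 1))) x :=
      ((hasDerivAt_neg x).rpow_const (Or.inl (by linarith))).const_mul c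
    have he : signedPow c α =ᶠ[nhds x] fun y => c * (-y) ^ α := by
      filter_upwards [eventually_lt_nhds h] with y hy
      simp [signedPow, not_le.2 hy]
    refine (hd.congr_of_eventuallyEq he).congr_deriv ?_
    simp only [signedPow, not_le.2 h, if_false]
    rw [Real.rpow_sub_one (by linarith)]
    field_simp
  · have hd : HasDerivAt (fun y : ℝ => y ^ α) (α * x ^ (α - 1)) x :=
      Real.hasDerivAt_rpow_const (Or.inl hx)
    have he : signedPow c α =ᶠ[nhds x] fun y => y ^ α := by
      filter_upwards [eventually_gt_nhds h] with y hy
      simp [signedPow, hy.le]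
    refine (hd.congr_of_eventuallyEq he).congr_deriv ?_
    simp only [signedPow, h.le, if_true]
    rw [Real.rpow_sub_one hx]
    field_simp

lemma gradient_bivariateMonomial (c₁ c₂ α₁ α₂ : ℝ) {x : EuclideanSpace ℝ (Fin 2)}
    (h₀ : x 0 ≠ 0) (h₁ : x 1 ≠ 0) :
    gradient (bivariateMonomial c₁ c₂ α₁ α₂) x =
      bivariateMonomial c₁ c₂ α₁ α₂ x • !₂[α₁ / x 0, α₂ / x 1] := by
  refine HasGradientAt.gradient ?_
  rw [hasGradientAt_iff_hasFDerivAt]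
  have p₀ : HasFDerivAt (fun y : EuclideanSpace ℝ (Fin 2) => y 0)
      (EuclideanSpace.proj (𝕜 := ℝ) (0 : Fin 2)) x :=
    (EuclideanSpace.proj (𝕜 := ℝ) (0 : Fin 2)).hasFDerivAt
  have p₁ : HasFDerivAt (fun y : EuclideanSpace ℝ (Fin 2) => y 1)
      (EuclideanSpace.proj (𝕜 := ℝ) (1 : Fin 2)) x :=
    (EuclideanSpace.proj (𝕜 := ℝ) (1 : Fin 2)).hasFDerivAt
  have := ((hasDerivAt_signedPow c₁ α₁ h₀).comp_hasFDerivAt x p₀).mul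
    ((hasDerivAt_signedPow c₂ α₂ h₁).comp_hasFDerivAt x p₁)
  refine this.congr_fderiv ?_
  ext v
  simp [PiLp.inner_apply, Fin.sum_univ_two, bivariateMonomial]
  ring

lemma waldRatio_bivariateMonomial {c₁ c₂ : ℝ} (hc₁ : c₁ ≠ 0) (hc₂ : c₂ ≠ 0) (α₁ α₂ : ℝ)
    {S : Matrix (Fin 2) (Fin 2) ℝ} (hS : S.PosSemidef) {x : EuclideanSpace ℝ (Fin 2)}
    (h₀ : x 0 ≠ 0) (h₁ : x 1 ≠ 0) :
    waldRatio (bivariateMonomial c₁ c₂ α₁ α₂) S x = x 0 ^ 2 * x 1 ^ 2 /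
      (α₁ ^ 2 * S 0 0 * x 1 ^ 2 + 2 * α₁ * α₂ * S 0 1 * x 0 * x 1 + α₂ ^ 2 * S 1 1 * x 0 ^ 2) := by
  have h₂₁ : S 1 0 = S 0 1 := by simpa using hS.isHermitian.apply 0 1
  have hf : bivariateMonomial c₁ c₂ α₁ α₂ x ≠ 0 :=
    mul_ne_zero (signedPow_ne_zero hc₁ _ h₀) (signedPow_ne_zero hc₂ _ h₁)
  have hx : x 0 ^ 2 * x 1 ^ 2 ≠ 0 := by positivity
  rw [waldRatio, gradient_bivariateMonomial _ _ _ _ h₀ h₁]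
  set F := bivariateMonomial c₁ c₂ α₁ α₂ x
  have e : (F • !₂[α₁ / x 0, α₂ / x 1]).ofLp ⬝ᵥ S.mulVec (F • !₂[α₁ / x 0, α₂ / x 1]).ofLp =
      F ^ 2 * ((α₁ ^ 2 * S 0 0 * x 1 ^ 2 + 2 * α₁ * α₂ * S 0 1 * x 0 * x 1 +
        α₂ ^ 2 * S 1 1 * x 0 ^ 2) / (x 0 ^ 2 * x 1 ^ 2)) := by
    simp [dotProduct, Matrix.mulVec, Fin.sum_univ_two, h₂₁]
    field_simp
    ring
  rw [e, div_mul_cancel_left₀ (pow_ne_zero 2 hf), inv_div]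

/-! ### Law of the ratio -/

open Real in
/-- The closed form of the ratio, evaluated at a correlated Gaussian pair, is distributed as a
scaled chi-square variable. -/
lemma map_gaussianReal_prod_ratio {α₁ α₂ σ₁ σ₂ ρ τ : ℝ} (hα₁ : 0 < α₁) (hα₂ : 0 < α₂)
    (hσ₁ : σ₁ ≠ 0) (hσ₂ : σ₂ ≠ 0) (h : ρ ^ 2 + τ ^ 2 = 1) :
    ((gaussianReal 0 1).prod (gaussianReal 0 1)).map (fun z =>
      (σ₁ * z.1) ^ 2 * (σ₂ * (ρ * z.1 + τ * z.2)) ^ 2 /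
        (α₁ ^ 2 * σ₁ ^ 2 * (σ₂ * (ρ * z.1 + τ * z.2)) ^ 2 +
          2 * α₁ * α₂ * (ρ * σ₁ * σ₂) * (σ₁ * z.1) * (σ₂ * (ρ * z.1 + τ * z.2)) +
          α₂ ^ 2 * σ₂ ^ 2 * (σ₁ * z.1) ^ 2)) =
      chiSquareOne.map (fun w => w / (α₁ + α₂) ^ 2) := by
  have hc : 0 < α₁ + α₂ := add_pos hα₁ hα₂
  -- The chi-square side is lifted to the pair through its first coordinate r cos t.
  have hchi : chiSquareOne.map (fun w => w / (α₁ + α₂) ^ 2) =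
      ((gaussianReal 0 1).prod (gaussianReal 0 1)).map
        (fun z => 1 / (α₁ + α₂) ^ 2 * z.1 ^ 2) := by
    have : (gaussianReal 0 1) = ((gaussianReal 0 1).prod (gaussianReal 0 1)).map Prod.fst := by
      simp
    rw [chiSquareOne, Measure.map_map (by fun_prop) (by fun_prop)]
    conv_lhs => rw [this]
    rw [Measure.map_map (by fun_prop) (by fun_prop)]
    congr 1 with z
    simp only [Function.comp_apply]
    ring
  rw [hchi]
  refine map_gaussianReal_prod_eq_of_angular (by fun_prop) (by fun_prop) (by fun_prop) (by fun_prop)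
    (1 / (α₁ + α₂) ^ 2) ?_ ?_ (map_angularPart_eq (p := α₁ / (α₁ + α₂)) (q := α₂ / (α₁ + α₂))
      (by positivity) (by positivity) (by field_simp) h)
  · intro r t hr
    simp only
    set c := cos t
    have e : ρ * (r * c) + τ * (r * sin t) = r * (ρ * c + τ * sin t) := by ring
    rw [e]
    generalize ρ * c + τ * sin t = Y
    have e1 : (σ₁ * (r * c)) ^ 2 * (σ₂ * (r * Y)) ^ 2 =
        (σ₁ ^ 2 * σ₂ ^ 2 * r ^ 2) * (r ^ 2 * (c ^ 2 * Y ^ 2)) := by ring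
    have e2 : α₁ ^ 2 * σ₁ ^ 2 * (σ₂ * (r * Y)) ^ 2 +
          2 * α₁ * α₂ * (ρ * σ₁ * σ₂) * (σ₁ * (r * c)) * (σ₂ * (r * Y)) +
          α₂ ^ 2 * σ₂ ^ 2 * (σ₁ * (r * c)) ^ 2 =
        (σ₁ ^ 2 * σ₂ ^ 2 * r ^ 2) * ((α₁ + α₂) ^ 2 * ((α₁ / (α₁ + α₂)) ^ 2 * Y ^ 2 +
          2 * (α₁ / (α₁ + α₂)) * (α₂ / (α₁ + α₂)) * ρ * c * Y + (α₂ / (α₁ + α₂)) ^ 2 * c ^ 2)) := by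
      field_simp
    rw [e1, e2, mul_div_mul_left _ _ (by positivity), mul_div_mul_comm]
    ring
  · intro r t _
    ring

/-- The marginal has positive variance, hence no atoms, even for singular S. -/
lemma ae_ne_zero_multivariateGaussian {S : Matrix (Fin 2) (Fin 2) ℝ} (hS : S.PosSemidef) {i : Fin 2}
    (hi : 0 < S i i) : ∀ᵐ x ∂multivariateGaussian 0 S, x i ≠ 0 := by
  have hmp := measurePreserving_eval_multivariateGaussian (μ := 0) hS (i := i)
  have := nullSingletonClass_gaussianReal (μ := (0 : EuclideanSpace ℝ (Fin 2)) i)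
    (v := (S i i).toNNReal) (by simpa using hi)
  exact hmp.quasiMeasurePreserving.ae (Measure.ae_ne _ 0)

theorem theorem3p1 (α₁ α₂ : ℝ) (hα₁ : 0 < α₁) (hα₂ : 0 < α₂)
    (c₁ c₂ : ℝ) (hc₁ : c₁ ≠ 0) (hc₂ : c₂ ≠ 0)
    (S : Matrix (Fin 2) (Fin 2) ℝ) (hS : S.PosSemidef) (hdiag : ∀ i, 0 < S i i)
    {Ω : Type*} [MeasurableSpace Ω] (P : Measure Ω)
    (X : Ω → EuclideanSpace ℝ (Fin 2)) (hX : HasLaw X (multivariateGaussian 0 S) P) :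
    HasLaw (fun ω => waldRatio (bivariateMonomial c₁ c₂ α₁ α₂) S (X ω))
      (chiSquareOne.map (fun w => w / (α₁ + α₂) ^ 2)) P := by
  refine HasLaw.fun_comp (Y := waldRatio (bivariateMonomial c₁ c₂ α₁ α₂) S) ?_ hX
  set R : EuclideanSpace ℝ (Fin 2) → ℝ := fun x => x 0 ^ 2 * x 1 ^ 2 /
    (α₁ ^ 2 * S 0 0 * x 1 ^ 2 + 2 * α₁ * α₂ * S 0 1 * x 0 * x 1 + α₂ ^ 2 * S 1 1 * x 0 ^ 2) with hR
  have hRm : Measurable R := by fun_prop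
  refine HasLaw.congr (X := R) ⟨hRm.aemeasurable, ?_⟩ ?_
  · obtain ⟨σ₁, hσ₁, h₁⟩ : ∃ σ : ℝ, 0 < σ ∧ S 0 0 = σ ^ 2 :=
      ⟨√(S 0 0), Real.sqrt_pos.2 (hdiag 0), (Real.sq_sqrt (hdiag 0).le).symm⟩
    obtain ⟨σ₂, hσ₂, h₂⟩ : ∃ σ : ℝ, 0 < σ ∧ S 1 1 = σ ^ 2 :=
      ⟨√(S 1 1), Real.sqrt_pos.2 (hdiag 1), (Real.sq_sqrt (hdiag 1).le).symm⟩
    obtain ⟨ρ, h₁₂⟩ : ∃ ρ : ℝ, S 0 1 = ρ * σ₁ * σ₂ := ⟨S 0 1 / (σ₁ * σ₂), by field_simp⟩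
    -- det S = σ₁²σ₂²(1 - ρ²) ≥ 0, so τ = √(1 - ρ²) is available.
    have hρ : ρ ^ 2 ≤ 1 := by
      have h₂₁ : S 1 0 = S 0 1 := by simpa using hS.isHermitian.apply 0 1
      have hdet := hS.det_nonneg
      rw [Matrix.det_fin_two, h₂₁, h₁, h₂, h₁₂] at hdet
      have hpos : 0 < σ₁ ^ 2 * σ₂ ^ 2 := by positivity
      by_contra! hlt
      nlinarith
    have h : ρ ^ 2 + √(1 - ρ ^ 2) ^ 2 = 1 := by
      rw [Real.sq_sqrt (by linarith)]; ring
    rw [multivariateGaussian_fin_two_eq_map hS h h₁ h₂ h₁₂,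
      Measure.map_map hRm (Continuous.measurable (by fun_prop)),
      ← map_gaussianReal_prod_ratio hα₁ hα₂ hσ₁.ne' hσ₂.ne' h]
    congr 1 with z
    simp [hR, h₁, h₂, h₁₂]
  · filter_upwards [ae_ne_zero_multivariateGaussian hS (hdiag 0),
      ae_ne_zero_multivariateGaussian hS (hdiag 1)] with x h₀ h₁
    exact waldRatio_bivariateMonomial hc₁ hc₂ α₁ α₂ hS h₀ h₁
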